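/- Write $\lambda$ for Lebesgue measure on $\mathbb{R}$ and $|K|=\lambda(K)$. For a compact set $K\subseteq\mathbb{R}$ of positive measure put \[ \pi_K(x)=\lambda([\min K,x]\cap K),\qquad J_Kf(x)=\int_{[\min K,x]\cap K}f\,d\lambda,\qquad \|f\|_A=\sup_{x\in K}|J_Kf(x)|\qquad (x\in K,\ f\in L^\infty(K)), \] where $L^\infty(K)$ is the space of real-valued essentially bounded functions on $K$. Write $\pi_K^{-1}(t)=\{x\in K:\pi_K(x)=t\}$, and for $t\in[0,|K|]$ let $\sigma_K(t)=\min\pi_K^{-1}(t)$; let $E_K$ be the set of $t\in[0,|K|]$ for which $\pi_K^{-1}(t)$ has more than one point. Let $K,M\subseteq\mathbb{R}$ be compact sets of positive measure and let $\psi:[0,|M|]\to[0,|K|]$ be an increasing bi-Lipschitz bijection such that $K$ and $M$ are fiber $\psi$-compatible, that is, $\psi(E_M)=E_K$ and, for every $s\in E_M$, there is an increasing bijection $\pi_M^{-1}(s)\to\pi_K^{-1}(\psi(s))$. Let $\varepsilon\in\{1,-1\}$. Then: 1. There is exactly one surjective linear isometry $T:(L^\infty(K),\|\cdot\|_A)\to(L^\infty(M),\|\cdot\|_A)$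 associated to $\psi$ with sign $\varepsilon$, that is, such that $J_M(Tf)=\varepsilon\,(J_Kf)\circ\sigma_K\circ\psi\circ\pi_M$ on $M$ for every $f\in L^\infty(K)$. 2. There is an increasing homeomorphism $\phi:M\to K$ with $\pi_K\circ\phi=\psi\circ\pi_M$. 3. Every increasing homeomorphism $\phi:M\to K$ with $\pi_K\circ\phi=\psi\circ\pi_M$ agrees a.e. on $M$ with $\sigma_K\circ\psi\circ\pi_M$, and the isometry $T$ in 1 satisfies, for every $f\in L^\infty(K)$, \[ (Tf)(y)=\varepsilon\,f(\phi(y))\,\psi'(\pi_M(y))\qquad\text{for a.e. }y\in M. \] -/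

import Mathlib

open MeasureTheory Set
open scoped ENNReal

namespace Alexiewicz

noncomputable section

/-- The space `L^∞(K)` of (classes of) real-valued essentially bounded functions on `K`. -/
abbrev LInf (K : Set ℝ) : Type := Lp ℝ ∞ (volume.restrict K)

/-- The primitive `J_K f (x) = ∫_{[min K, x] ∩ K} f dλ`. -/
def J (K : Set ℝ) (f : LInf K) (x : ℝ) : ℝ := ∫ z in Icc (sInf K) x ∩ K, f z

/-- The Alexiewicz norm `‖f‖_A = sup_{x ∈ K} |J_K f (x)|`. -/
def normA (K : Set ℝ) (f : LInf K) : ℝ := ⨆ x : K, |J K f x|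

/-- The measure projection `π_K(x) = λ([min K, x] ∩ K)`; only its values on `K` matter. -/
def proj (K : Set ℝ) (x : ℝ) : ℝ := volume.real (Icc (sInf K) x ∩ K)

/-- The fiber `π_K⁻¹(t) = {x ∈ K : π_K(x) = t}`. -/
def fiber (K : Set ℝ) (t : ℝ) : Set ℝ := {x ∈ K | proj K x = t}

/-- The left-endpoint selector `σ_K(t) = min π_K⁻¹(t)`. For compact `K` of positive measure and
`t ∈ [0, |K|]` the fiber is compact and nonempty, so the infimum is a minimum. -/
def sel (K : Set ℝ) (t : ℝ) : ℝ := sInf (fiber K t)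

/-- The set `E_K` of those `t ∈ [0, |K|]` whose fiber has more than one point. -/
def E (K : Set ℝ) : Set ℝ := {t ∈ Icc 0 (volume.real K) | (fiber K t).Nontrivial}

/-- `ψ` restricts to an increasing lipeomorphism (bi-Lipschitz bijection) `[0, a] → [0, b]`.
Values of `ψ` outside `[0, a]` are irrelevant. -/
structure IsIncreasingLipeo (a b : ℝ) (ψ : ℝ → ℝ) : Prop where
  strictMonoOn : StrictMonoOn ψ (Icc 0 a)
  bijOn : BijOn ψ (Icc 0 a) (Icc 0 b)
  lipschitz : ∃ C, LipschitzOnWith C ψ (Icc 0 a)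
  lipschitz_inv : ∃ C, AntilipschitzWith C ((Icc 0 a).domRestrict ψ)

/-- `K` and `M` are fiber `ψ`-compatible: `ψ(E_M) = E_K` and corresponding fibers are
order-isomorphic. -/
def FiberCompatible (K M : Set ℝ) (ψ : ℝ → ℝ) : Prop :=
  ψ '' E M = E K ∧ ∀ s ∈ E M, Nonempty (fiber M s ≃o fiber K (ψ s))

/-- `φ` is an increasing homeomorphism `M → K` with `π_K ∘ φ = ψ ∘ π_M`. -/
def IsIncreasingLift (K M : Set ℝ) (ψ : ℝ → ℝ) (φ : M ≃ₜ K) : Prop :=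
  StrictMono φ ∧ ∀ y : M, proj K (φ y) = ψ (proj M y)

/-- `T` is a surjective linear isometry `(L^∞(K), ‖·‖_A) → (L^∞(M), ‖·‖_A)` associated to `ψ`,
with sign `ε`: `J_M (T f) = ε (J_K f) ∘ σ_K ∘ ψ ∘ π_M` on `M` for all `f`. -/
structure IsAssociatedIsometry (K M : Set ℝ) (ψ : ℝ → ℝ) (ε : ℝ)
    (T : LInf K →ₗ[ℝ] LInf M) : Prop where
  surjective : Function.Surjective T
  isometry : ∀ f, normA M (T f) = normA K f
  primitive : ∀ f, ∀ y ∈ M, J M (T f) y = ε * J K f (sel K (ψ (proj M y)))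

end

end Alexiewicz

namespace Alexiewicz

/-! ### Projection of a compact set onto an interval. -/

section Projection

variable {K : Set ℝ}

/-! The map `proj K` closes up the gaps of `K` and carries Lebesgue measure on `K` to Lebesgue
measure on `[0, |K|]` (`map_proj`). Hence primitives are constant on its fibers (`J_congr_proj`),
and almost every point of `K` is the least point of its fiber (`sel_proj_ae`).

A lift `φ` exists because `ψ` matches the levels and compatibility matches the fibers: gluing the
fiber isomorphisms gives an order isomorphism, which compactness makes a homeomorphism
(`exists_isIncreasingLift`). Any lift carries the measure with density `ψ' ∘ π_M` on `M` to Lebesgue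
measure on `K` (`map_zeroExtend`), so `f ↦ ε (f ∘ φ) (ψ' ∘ π_M)` turns the primitive `J f` into `ε
(J f) ∘ φ` (`J_weightedComp`). This preserves the norm since `φ` is onto, and the operator is
surjective since `ψ'` is bounded away from zero. A function is determined by its primitive
(`LInf_ext`), so the associated isometry is unique and every lift gives a formula for it. -/

theorem Icc_sInf_inter (hK : IsCompact K) (x : ℝ) : Icc (sInf K) x ∩ K = Iic x ∩ K := by
  ext z
  constructor
  · rintro ⟨h, hz⟩
    exact ⟨h.2, hz⟩
  · rintro ⟨h, hz⟩
    exact ⟨⟨csInf_le hK.bddBelow hz, h⟩, hz⟩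

theorem proj_eq (hK : IsCompact K) (x : ℝ) : proj K x = volume.real (Iic x ∩ K) := by
  rw [proj, Icc_sInf_inter hK]

theorem J_eq (hK : IsCompact K) (f : LInf K) (x : ℝ) :
    J K f x = ∫ z in Iic x, f z ∂(volume.restrict K) := by
  rw [J, Icc_sInf_inter hK, Measure.restrict_restrict measurableSet_Iic]

theorem volume_Iic_inter (hK : IsCompact K) (x : ℝ) :
    volume (Iic x ∩ K) = ENNReal.ofReal (proj K x) := by
  rw [proj_eq hK, measureReal_def, ENNReal.ofReal_toReal]
  exact ((measure_mono inter_subset_right).trans_lt hK.measure_lt_top).ne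

theorem proj_mono (hK : IsCompact K) : Monotone (proj K) := by
  intro x y h
  rw [proj_eq hK, proj_eq hK]
  exact measureReal_mono (inter_subset_inter_left _ (Iic_subset_Iic.2 h))
    ((measure_mono inter_subset_right).trans_lt hK.measure_lt_top).ne

theorem proj_mem_Icc (hK : IsCompact K) (x : ℝ) : proj K x ∈ Icc 0 (volume.real K) := by
  rw [proj_eq hK]
  exact ⟨measureReal_nonneg, measureReal_mono inter_subset_right hK.measure_lt_top.ne⟩

theorem proj_lipschitz (hK : IsCompact K) : LipschitzWith 1 (proj K) := by
  refine LipschitzWith.of_le_add fun x y => ?_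
  rcases le_total x y with h | h
  · exact (proj_mono hK h).trans (le_add_of_nonneg_right dist_nonneg)
  · rw [proj_eq hK, proj_eq hK, Real.dist_eq, abs_of_nonneg (sub_nonneg.2 h)]
    have hsub : Iic x ∩ K ⊆ (Iic y ∩ K) ∪ Ioc y x := by
      rintro z ⟨hz, hzK⟩
      by_cases hzy : z ≤ y
      · exact Or.inl ⟨hzy, hzK⟩
      · exact Or.inr ⟨not_le.1 hzy, hz⟩
    have hfin : volume (Iic y ∩ K) ≠ ∞ :=
      ((measure_mono inter_subset_right).trans_lt hK.measure_lt_top).ne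
    calc volume.real (Iic x ∩ K) ≤ volume.real ((Iic y ∩ K) ∪ Ioc y x) :=
          measureReal_mono hsub (measure_union_ne_top hfin (by simp))
      _ ≤ volume.real (Iic y ∩ K) + volume.real (Ioc y x) := measureReal_union_le _ _
      _ = _ := by rw [Real.volume_real_Ioc_of_le h]

theorem proj_measurable (hK : IsCompact K) : Measurable (proj K) := (proj_mono hK).measurable

/-- A point with a point of `K` to its left may be moved into `K` without changing the part
of `K` to its left. -/
theorem exists_mem_Iic_inter_eq (hK : IsCompact K) {x : ℝ} (hx : (Iic x ∩ K).Nonempty) :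
    ∃ z ∈ K, z ≤ x ∧ Iic x ∩ K = Iic z ∩ K := by
  obtain ⟨z, ⟨hzx, hzK⟩, hz⟩ := (hK.inter_left (isClosed_Iic (a := x))).exists_isGreatest hx
  refine ⟨z, hzK, hzx, ?_⟩
  ext w
  exact ⟨fun hw => ⟨hz hw, hw.2⟩, fun hw => ⟨(show w ≤ z from hw.1).trans hzx, hw.2⟩⟩

theorem fiber_nonempty (hK : IsCompact K) (hK0 : 0 < volume K) {t : ℝ}
    (ht : t ∈ Icc 0 (volume.real K)) : (fiber K t).Nonempty := by
  have hne : K.Nonempty := nonempty_of_measure_ne_zero hK0.ne'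
  obtain ⟨a, haK, ha⟩ := hK.exists_isLeast hne
  obtain ⟨b, hbK, hb⟩ := hK.exists_isGreatest hne
  have h0 : proj K a = 0 := by
    have : Iic a ∩ K ⊆ {a} := fun z hz => le_antisymm hz.1 (ha hz.2)
    rw [proj_eq hK, measureReal_def, measure_mono_null this (by simp), ENNReal.toReal_zero]
  have h1 : proj K b = volume.real K := by
    rw [proj_eq hK, inter_eq_right.2 (show K ⊆ Iic b from fun z hz => hb hz)]
  have hiv := intermediate_value_Icc (ha hbK) (proj_lipschitz hK).continuous.continuousOn
  rw [h0, h1] at hiv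
  obtain ⟨x, hx, hxt⟩ := hiv ht
  -- The intermediate value `x` may lie in a gap of `K`.
  obtain ⟨z, hzK, -, hz⟩ := exists_mem_Iic_inter_eq hK ⟨a, hx.1, haK⟩
  exact ⟨z, hzK, by rw [proj_eq hK, ← hz, ← proj_eq hK, hxt]⟩

theorem sel_isLeast (hK : IsCompact K) (hK0 : 0 < volume K) {t : ℝ}
    (ht : t ∈ Icc 0 (volume.real K)) : IsLeast (fiber K t) (sel K t) := by
  have hc : IsCompact (fiber K t) :=
    hK.inter_right (isClosed_singleton.preimage (proj_lipschitz hK).continuous)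
  exact hc.isLeast_sInf (fiber_nonempty hK hK0 ht)

/-- It suffices to compare half-lines. For `t ≥ 0` the part of `K` projecting below `t` is compact;
it is cut off at its greatest point `b`, and `b` projects to `min t |K|` because that level is
attained. -/
theorem map_proj (hK : IsCompact K) (hK0 : 0 < volume K) :
    (volume.restrict K).map (proj K) = volume.restrict (Icc 0 (volume.real K)) := by
  have : IsFiniteMeasure (volume.restrict K) := ⟨by simpa using hK.measure_lt_top⟩
  refine Measure.ext_of_Iic _ _ fun t => ?_
  have hpre : MeasurableSet (proj K ⁻¹' Iic t) := proj_measurable hK measurableSet_Iic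
  rw [Measure.map_apply (proj_measurable hK) measurableSet_Iic, Measure.restrict_apply hpre,
    Measure.restrict_apply measurableSet_Iic]
  rcases lt_or_ge t 0 with ht | ht
  · have h1 : proj K ⁻¹' Iic t ∩ K = ∅ := by
      ext z
      simpa using fun h : proj K z ≤ t => absurd ((proj_mem_Icc hK z).1.trans h) (not_le.2 ht)
    have h2 : Iic t ∩ Icc 0 (volume.real K) = ∅ := by
      ext z
      simp only [mem_inter_iff, mem_Iic, mem_Icc, mem_empty_iff_false, iff_false]
      rintro ⟨h, h', -⟩
      linarith
    rw [h1, h2, measure_empty]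
  have h2 : Iic t ∩ Icc 0 (volume.real K) = Icc 0 (min t (volume.real K)) := by
    ext z
    simp only [mem_inter_iff, mem_Iic, mem_Icc, le_min_iff]
    tauto
  have hm : min t (volume.real K) ∈ Icc 0 (volume.real K) :=
    ⟨le_min ht measureReal_nonneg, min_le_right _ _⟩
  have hpt : IsCompact (proj K ⁻¹' Iic t ∩ K) :=
    hK.inter_left (isClosed_Iic.preimage (proj_lipschitz hK).continuous)
  obtain ⟨w, hwK, hw⟩ := fiber_nonempty hK hK0 hm
  have hw' : proj K w ≤ t := hw.le.trans (min_le_left _ _)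
  obtain ⟨b, ⟨hbt, hbK⟩, hb⟩ := hpt.exists_isGreatest ⟨w, hw', hwK⟩
  have h1 : proj K ⁻¹' Iic t ∩ K = Iic b ∩ K := by
    ext z
    exact ⟨fun hz => ⟨hb hz, hz.2⟩, fun hz => ⟨(proj_mono hK hz.1).trans hbt, hz.2⟩⟩
  have h3 : proj K b = min t (volume.real K) :=
    le_antisymm (le_min hbt (proj_mem_Icc hK b).2) (hw ▸ proj_mono hK (hb ⟨hw', hwK⟩))
  rw [h1, h2, volume_Iic_inter hK, h3, Real.volume_Icc, sub_zero]

theorem volume_fiber (hK : IsCompact K) (hK0 : 0 < volume K) (t : ℝ) :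
    volume (fiber K t) = 0 := by
  have h : fiber K t = proj K ⁻¹' {t} ∩ K := by
    ext z
    exact and_comm
  have hm := proj_measurable hK (measurableSet_singleton t)
  rw [h, ← Measure.restrict_apply hm, ← Measure.map_apply (proj_measurable hK)
    (measurableSet_singleton t), map_proj hK hK0]
  simp

/-- The set cut off from `K` at a point of `K` depends, up to a null set, only on the projection
of that point. -/
theorem Iic_ae_eq_preimage (hK : IsCompact K) (hK0 : 0 < volume K) (x : ℝ) :
    Iic x =ᵐ[volume.restrict K] proj K ⁻¹' Iic (proj K x) := by
  have : IsFiniteMeasure (volume.restrict K) := ⟨by simpa using hK.measure_lt_top⟩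
  refine ae_eq_of_subset_of_measure_ge (fun z hz => proj_mono hK hz) ?_
    measurableSet_Iic.nullMeasurableSet (measure_ne_top _ _)
  have h2 : Iic (proj K x) ∩ Icc 0 (volume.real K) ⊆ Icc 0 (proj K x) :=
    fun z hz => ⟨hz.2.1, hz.1⟩
  rw [← Measure.map_apply (proj_measurable hK) measurableSet_Iic, map_proj hK hK0,
    Measure.restrict_apply measurableSet_Iic, Measure.restrict_apply measurableSet_Iic,
    volume_Iic_inter hK]
  exact (measure_mono h2).trans (by rw [Real.volume_Icc, sub_zero])

/-- Between an exceptional point and the minimum of its fiber lies a rational with the same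
projection, so the exceptional points lie in countably many null fibers. -/
theorem sel_proj_ae (hK : IsCompact K) (hK0 : 0 < volume K) :
    ∀ᵐ x ∂(volume.restrict K), sel K (proj K x) = x := by
  rw [ae_restrict_iff' hK.measurableSet]
  have hnull : volume (⋃ q : ℚ, fiber K (proj K q)) = 0 :=
    measure_iUnion_null fun q => volume_fiber hK hK0 _
  refine measure_mono_null (fun x hx => ?_) hnull
  simp only [mem_compl_iff, mem_ofPred_eq, Classical.not_imp] at hx
  obtain ⟨hxK, hne⟩ := hx
  have hl := sel_isLeast hK hK0 (proj_mem_Icc hK x)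
  obtain ⟨q, hq1, hq2⟩ := exists_rat_btwn (lt_of_le_of_ne (hl.2 ⟨hxK, rfl⟩) hne)
  refine mem_iUnion.2 ⟨q, hxK, le_antisymm ?_ (proj_mono hK hq2.le)⟩
  rw [← hl.1.2]
  exact proj_mono hK hq1.le

theorem J_congr_proj (hK : IsCompact K) (hK0 : 0 < volume K) (f : LInf K) {x y : ℝ}
    (h : proj K x = proj K y) : J K f x = J K f y := by
  rw [J_eq hK, J_eq hK, setIntegral_congr_set (Iic_ae_eq_preimage hK hK0 x),
    setIntegral_congr_set (Iic_ae_eq_preimage hK hK0 y), h]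

theorem LInf_integrable (hK : IsCompact K) (f : LInf K) : Integrable f (volume.restrict K) := by
  have : IsFiniteMeasure (volume.restrict K) := ⟨by simpa using hK.measure_lt_top⟩
  exact (Lp.memLp f).integrable le_top

end Projection

/-! ### Determination of a function by its primitive. -/

/-- A function with vanishing integrals over all lower half-lines vanishes almost everywhere. -/
theorem ae_eq_zero_of_forall_setIntegral_Iic {μ : Measure ℝ} {f : ℝ → ℝ} (hf : Integrable f μ)
    (h : ∀ x, ∫ z in Iic x, f z ∂μ = 0) : f =ᵐ[μ] 0 := by
  refine hf.ae_eq_zero_of_forall_setIntegral_eq_zero fun s hs hlt => ?_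
  clear hlt
  -- The total integral is needed for complements in the π-λ induction.
  have huniv : ∫ z, f z ∂μ = 0 := by
    have hU : (⋃ n : ℕ, Iic (n : ℝ)) = univ := by
      ext x
      simpa using exists_nat_ge x
    have ht := tendsto_setIntegral_of_monotone (μ := μ) (f := f) (s := fun n : ℕ => Iic (n : ℝ))
      (fun _ => measurableSet_Iic) (fun m n hmn => Iic_subset_Iic.2 (by exact_mod_cast hmn))
      hf.integrableOn
    rw [hU, setIntegral_univ] at ht
    exact tendsto_nhds_unique ht (by simp [h])
  induction s, hs using MeasurableSpace.induction_on_inter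
    (BorelSpace.measurable_eq.trans (borel_eq_generateFrom_Iic ℝ)) isPiSystem_Iic with
  | empty => simp
  | basic t ht =>
    obtain ⟨x, rfl⟩ := ht
    exact h x
  | compl t ht ih =>
    have := integral_add_compl ht hf
    rw [ih, huniv, zero_add] at this
    exact this
  | iUnion t hd ht ih =>
    rw [integral_iUnion ht hd hf.integrableOn]
    simp [ih]

theorem LInf_ext (K : Set ℝ) (hK : IsCompact K) {f g : LInf K}
    (h : ∀ x ∈ K, J K f x = J K g x) : f = g := by
  have hf := LInf_integrable hK f
  have hg := LInf_integrable hK g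
  have key : ∀ x, ∫ z in Iic x, (f z - g z) ∂(volume.restrict K) = 0 := by
    intro x
    rcases (Iic x ∩ K).eq_empty_or_nonempty with he | hne
    · rw [Measure.restrict_restrict measurableSet_Iic, he]
      simp
    · obtain ⟨z, hzK, -, hz⟩ := exists_mem_Iic_inter_eq hK hne
      rw [Measure.restrict_restrict measurableSet_Iic, hz,
        ← Measure.restrict_restrict measurableSet_Iic,
        integral_sub hf.integrableOn hg.integrableOn, ← J_eq hK, ← J_eq hK, h z hzK, sub_self]
  apply Lp.ext
  filter_upwards [ae_eq_zero_of_forall_setIntegral_Iic (hf.sub hg) key] with z hz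
  exact sub_eq_zero.1 hz

/-! ### Derivative of the bi-Lipschitz map. -/

section Derivative

variable {a b : ℝ} {ψ : ℝ → ℝ}

theorem IsIncreasingLipeo.map_zero (hψ : IsIncreasingLipeo a b ψ) (ha : 0 ≤ a) : ψ 0 = 0 := by
  have h0 : (0 : ℝ) ∈ Icc 0 a := ⟨le_rfl, ha⟩
  have hb : 0 ≤ b := (hψ.bijOn.mapsTo h0).1.trans (hψ.bijOn.mapsTo h0).2
  obtain ⟨s, hs, hs0⟩ := hψ.bijOn.surjOn (⟨le_rfl, hb⟩ : (0 : ℝ) ∈ Icc 0 b)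
  exact le_antisymm (hs0 ▸ hψ.strictMonoOn.monotoneOn h0 hs hs.1) (hψ.bijOn.mapsTo h0).1

theorem IsIncreasingLipeo.deriv_bounds (hψ : IsIncreasingLipeo a b ψ) :
    ∃ c > 0, ∃ C, ∀ᵐ s ∂(volume.restrict (Icc 0 a)),
      c ≤ deriv ψ s ∧ deriv ψ s ≤ C ∧ derivWithin ψ (Icc 0 a) s = deriv ψ s := by
  obtain ⟨C, hC⟩ := hψ.lipschitz
  obtain ⟨D, hD⟩ := hψ.lipschitz_inv
  have hD1 : (0 : ℝ) < D + 1 := by positivity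
  -- `D + 1` replaces the antilipschitz constant `D`, which could be zero. The lower bound comes
  -- from monotonicity of `(D + 1) ψ - id`.
  refine ⟨1 / (D + 1), by positivity, C, ?_⟩
  rw [← restrict_Ioo_eq_restrict_Icc, ae_restrict_iff' measurableSet_Ioo]
  filter_upwards [hC.ae_differentiableWithinAt_of_mem] with s hs hsa
  have hnhds : Icc 0 a ∈ nhds s := Icc_mem_nhds hsa.1 hsa.2
  have hd : DifferentiableAt ℝ ψ s := (hs (Ioo_subset_Icc_self hsa)).differentiableAt hnhds
  refine ⟨?_, (le_abs_self _).trans (norm_deriv_le_of_lipschitzOn hnhds hC),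
    derivWithin_of_mem_nhds hnhds⟩
  have hmono : MonotoneOn (fun x => (D + 1 : ℝ) * ψ x - x) (Icc 0 a) := by
    intro x hx y hy hxy
    have h1 := hD.le_mul_dist ⟨x, hx⟩ ⟨y, hy⟩
    have h2 := hψ.strictMonoOn.monotoneOn hx hy hxy
    simp only [Set.domRestrict, Subtype.dist_eq] at h1
    rw [dist_comm x y, dist_comm (ψ x) (ψ y), Real.dist_eq, Real.dist_eq,
      abs_of_nonneg (sub_nonneg.2 hxy), abs_of_nonneg (sub_nonneg.2 h2)] at h1
    dsimp only
    linarith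
  have hderiv : HasDerivAt (fun x => (D + 1 : ℝ) * ψ x - x) ((D + 1) * deriv ψ s - 1) s :=
    (hd.hasDerivAt.const_mul _).sub (hasDerivAt_id s)
  have h3 := hmono.derivWithin_nonneg (x := s)
  rw [derivWithin_of_mem_nhds hnhds, hderiv.deriv] at h3
  rw [div_le_iff₀ hD1]
  linarith

theorem IsIncreasingLipeo.lintegral_deriv (hψ : IsIncreasingLipeo a b ψ) {t : ℝ}
    (ht : t ∈ Icc 0 a) : ∫⁻ s in Icc 0 t, ENNReal.ofReal (deriv ψ s) = ENNReal.ofReal (ψ t) := by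
  obtain ⟨C, hC⟩ := hψ.lipschitz
  obtain ⟨c, hc, C', hb⟩ := hψ.deriv_bounds
  have hsub : Icc 0 t ⊆ Icc 0 a := Icc_subset_Icc_right ht.2
  have hac : AbsolutelyContinuousOnInterval ψ 0 t := by
    apply LipschitzOnWith.absolutelyContinuousOnInterval (K := C)
    rw [uIcc_of_le ht.1]
    exact hC.mono hsub
  have hint := hac.intervalIntegrable_deriv
  rw [intervalIntegrable_iff_integrableOn_Icc_of_le ht.1] at hint
  have hnn : ∀ᵐ s ∂(volume.restrict (Icc 0 t)), 0 ≤ deriv ψ s :=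
    ae_mono (Measure.restrict_mono hsub le_rfl) (hb.mono fun s hs => hc.le.trans hs.1)
  rw [← ofReal_integral_eq_lintegral_ofReal hint hnn, integral_Icc_eq_integral_Ioc,
    ← intervalIntegral.integral_of_le ht.1, hac.integral_deriv_eq_sub,
    hψ.map_zero (ht.1.trans ht.2), sub_zero]

end Derivative

end Alexiewicz

namespace Alexiewicz

theorem LInf_exists_bound {K : Set ℝ} (f : LInf K) :
    ∃ B, ∀ᵐ x ∂(volume.restrict K), ‖f x‖ ≤ B := by
  refine ⟨(eLpNormEssSup f (volume.restrict K)).toReal, ?_⟩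
  have hfin : eLpNormEssSup f (volume.restrict K) ≠ ∞ := by
    rw [← eLpNorm_exponent_top]
    exact (Lp.memLp f).eLpNorm_ne_top
  filter_upwards [ae_le_eLpNormEssSup (f := f) (μ := volume.restrict K)] with x hx
  have := ENNReal.toReal_mono hfin hx
  simpa using this

/-- The measure on `M` with density `ψ' ∘ π_M`. -/
noncomputable def pullbackMeasure (M : Set ℝ) (ψ : ℝ → ℝ) : Measure ℝ :=
  (volume.restrict M).withDensity fun y => ENNReal.ofReal (deriv ψ (proj M y))

/-- The extension by zero of a map `M → K` to the real line. -/
noncomputable def zeroExtend {K M : Set ℝ} (φ : M → K) : ℝ → ℝ :=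
  Function.extend Subtype.val (fun y => (φ y : ℝ)) 0

/-! ### The measure with density `ψ' ∘ π_M`. -/

section Weight

variable {M : Set ℝ} {ψ : ℝ → ℝ} {b : ℝ}

/-- Bounds valid almost everywhere on `[0, |M|]` pull back along `proj M` by `map_proj`. The two
derivatives can differ only on a null set; `deriv` is the one used as weight, being measurable for
every `ψ`. -/
theorem weight_bounds (hM : IsCompact M) (hM0 : 0 < volume M)
    (hψ : IsIncreasingLipeo (volume.real M) b ψ) :
    ∃ c > 0, ∃ C, ∀ᵐ y ∂(volume.restrict M),
      c ≤ deriv ψ (proj M y) ∧ deriv ψ (proj M y) ≤ C ∧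
        derivWithin ψ (Icc 0 (volume.real M)) (proj M y) = deriv ψ (proj M y) := by
  obtain ⟨c, hc, C, h⟩ := hψ.deriv_bounds
  rw [← map_proj hM hM0] at h
  exact ⟨c, hc, C, ae_of_ae_map (proj_measurable hM).aemeasurable h⟩

theorem weight_measurable (hM : IsCompact M) : Measurable fun y => deriv ψ (proj M y) :=
  (measurable_deriv ψ).comp (proj_measurable hM)

theorem pullbackMeasure_absolutelyContinuous :
    pullbackMeasure M ψ ≪ volume.restrict M := withDensity_absolutelyContinuous _ _

theorem absolutelyContinuous_pullbackMeasure (hM : IsCompact M) (hM0 : 0 < volume M)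
    (hψ : IsIncreasingLipeo (volume.real M) b ψ) :
    volume.restrict M ≪ pullbackMeasure M ψ := by
  obtain ⟨c, hc, C, h⟩ := weight_bounds hM hM0 hψ
  refine withDensity_absolutelyContinuous' (weight_measurable hM).ennreal_ofReal.aemeasurable ?_
  filter_upwards [h] with y hy
  exact (ENNReal.ofReal_pos.2 (hc.trans_le hy.1)).ne'

theorem pullbackMeasure_Iic (hM : IsCompact M) (hM0 : 0 < volume M)
    (hψ : IsIncreasingLipeo (volume.real M) b ψ) (y : ℝ) :
    pullbackMeasure M ψ (Iic y) = ENNReal.ofReal (ψ (proj M y)) := by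
  have ht := proj_mem_Icc hM y
  have hs : Iic (proj M y) ∩ Icc 0 (volume.real M) = Icc 0 (proj M y) := by
    ext z
    exact ⟨fun hz => ⟨hz.2.1, hz.1⟩, fun hz => ⟨hz.2, hz.1, hz.2.trans ht.2⟩⟩
  rw [pullbackMeasure, withDensity_apply _ measurableSet_Iic,
    setLIntegral_congr (Iic_ae_eq_preimage hM hM0 y),
    ← setLIntegral_map measurableSet_Iic (measurable_deriv ψ).ennreal_ofReal (proj_measurable hM),
    map_proj hM hM0, Measure.restrict_restrict measurableSet_Iic, hs, hψ.lintegral_deriv ht]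

end Weight

/-! ### Weighted composition along a lift. -/

section Lift

variable {K M : Set ℝ} {ψ : ℝ → ℝ} {φ : M ≃ₜ K}

theorem zeroExtend_apply (φ : M → K) {y : ℝ} (hy : y ∈ M) : zeroExtend φ y = φ ⟨y, hy⟩ :=
  Subtype.val_injective.extend_apply (fun y => (φ y : ℝ)) 0 ⟨y, hy⟩

theorem zeroExtend_measurable (hM : IsCompact M) {φ : M → K} (hφ : Continuous φ) :
    Measurable (zeroExtend φ) :=
  (MeasurableEmbedding.subtype_coe hM.measurableSet).measurable_extend
    (continuous_subtype_val.comp hφ).measurable measurable_const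

theorem pullbackMeasure_ae_mem (hM : IsCompact M) : ∀ᵐ y ∂(pullbackMeasure M ψ), y ∈ M :=
  pullbackMeasure_absolutelyContinuous.ae_le (ae_restrict_mem hM.measurableSet)

theorem Iic_ae_eq_zeroExtend (hM : IsCompact M) (hφ : StrictMono φ) (y : M) :
    Iic (y : ℝ) =ᵐ[pullbackMeasure M ψ] zeroExtend φ ⁻¹' Iic (φ y : ℝ) := by
  filter_upwards [pullbackMeasure_ae_mem hM] with z hz
  refine propext ?_
  change z ≤ y ↔ zeroExtend φ z ≤ φ y
  rw [zeroExtend_apply _ hz, Subtype.coe_le_coe, hφ.le_iff_le]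
  exact Iff.rfl

/-- Change of variables, checked on half-lines: one ending at `φ y` pulls back to one ending at `y`,
of mass `ψ (π_M y) = π_K (φ y)`. -/
theorem map_zeroExtend (hK : IsCompact K) (hM : IsCompact M) (hM0 : 0 < volume M)
    (hψ : IsIncreasingLipeo (volume.real M) (volume.real K) ψ) (hφ : IsIncreasingLift K M ψ φ) :
    (pullbackMeasure M ψ).map (zeroExtend φ) = volume.restrict K := by
  have : IsFiniteMeasure (volume.restrict K) := ⟨by simpa using hK.measure_lt_top⟩
  refine (Measure.ext_of_Iic _ _ fun x => ?_).symm
  rw [Measure.map_apply (zeroExtend_measurable hM φ.continuous) measurableSet_Iic,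
    Measure.restrict_apply measurableSet_Iic]
  rcases (Iic x ∩ K).eq_empty_or_nonempty with he | hne
  · rw [he, measure_empty, eq_comm, measure_eq_zero_iff_ae_notMem]
    filter_upwards [pullbackMeasure_ae_mem hM] with y hy hyx
    have hmem : (φ ⟨y, hy⟩ : ℝ) ∈ Iic x ∩ K :=
      ⟨by simpa [zeroExtend_apply _ hy] using hyx, (φ ⟨y, hy⟩).2⟩
    rw [he] at hmem
    exact hmem
  · obtain ⟨z, hzK, hzx, hz⟩ := exists_mem_Iic_inter_eq hK hne
    obtain ⟨y, hy⟩ := φ.surjective ⟨z, hzK⟩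
    have hyz : (φ y : ℝ) = z := congrArg Subtype.val hy
    have hset : zeroExtend φ ⁻¹' Iic x =ᵐ[pullbackMeasure M ψ] zeroExtend φ ⁻¹' Iic z := by
      filter_upwards [pullbackMeasure_ae_mem hM] with w hw
      refine propext ?_
      have hwK : zeroExtend φ w ∈ K := by
        rw [zeroExtend_apply _ hw]
        exact (φ ⟨w, hw⟩).2
      have hiff := Set.ext_iff.1 hz (zeroExtend φ w)
      exact ⟨fun h => (hiff.1 ⟨h, hwK⟩).1, fun h => (hiff.2 ⟨h, hwK⟩).1⟩
    rw [measure_congr hset, ← hyz, ← measure_congr (Iic_ae_eq_zeroExtend hM hφ.1 y),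
      pullbackMeasure_Iic hM hM0 hψ, hz, volume_Iic_inter hK, ← hφ.2 y, hyz]

theorem zeroExtend_quasiMeasurePreserving (hK : IsCompact K) (hM : IsCompact M)
    (hM0 : 0 < volume M) (hψ : IsIncreasingLipeo (volume.real M) (volume.real K) ψ)
    (hφ : IsIncreasingLift K M ψ φ) :
    Measure.QuasiMeasurePreserving (zeroExtend φ) (volume.restrict M) (volume.restrict K) := by
  refine ⟨zeroExtend_measurable hM φ.continuous, ?_⟩
  rw [← map_zeroExtend hK hM hM0 hψ hφ]
  exact (absolutelyContinuous_pullbackMeasure hM hM0 hψ).map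
    (zeroExtend_measurable hM φ.continuous)

theorem memLp_weightedComp (hK : IsCompact K) (hM : IsCompact M)
    (hM0 : 0 < volume M) (hψ : IsIncreasingLipeo (volume.real M) (volume.real K) ψ)
    (hφ : IsIncreasingLift K M ψ φ) (ε : ℝ) (f : LInf K) :
    MemLp (fun y => ε * f (zeroExtend φ y) * deriv ψ (proj M y)) ∞ (volume.restrict M) := by
  have hq := zeroExtend_quasiMeasurePreserving hK hM hM0 hψ hφ
  obtain ⟨c, hc, C, hw⟩ := weight_bounds hM hM0 hψ
  obtain ⟨B, hB⟩ := LInf_exists_bound f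
  refine memLp_top_of_bound ?_ (|ε| * B * C) ?_
  · exact (((Lp.aestronglyMeasurable f).comp_quasiMeasurePreserving hq).const_mul ε).mul
      (weight_measurable hM).aestronglyMeasurable
  · filter_upwards [hw, hq.ae hB] with y hy hBy
    rw [norm_mul, norm_mul, Real.norm_eq_abs ε, Real.norm_of_nonneg (hc.le.trans hy.1)]
    have hB0 : 0 ≤ B := (norm_nonneg _).trans hBy
    have hw0 := hc.le.trans hy.1
    gcongr
    exact hy.2.1

/-- The weighted composition operator `f ↦ ε (f ∘ φ) (ψ' ∘ π_M)`. -/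
theorem exists_weightedComp (hK : IsCompact K) (hM : IsCompact M)
    (hM0 : 0 < volume M) (hψ : IsIncreasingLipeo (volume.real M) (volume.real K) ψ)
    (hφ : IsIncreasingLift K M ψ φ) (ε : ℝ) :
    ∃ T : LInf K →ₗ[ℝ] LInf M, ∀ f, ∀ᵐ y ∂(volume.restrict M),
      T f y = ε * f (zeroExtend φ y) * deriv ψ (proj M y) := by
  have hq := zeroExtend_quasiMeasurePreserving hK hM hM0 hψ hφ
  have hL := memLp_weightedComp hK hM hM0 hψ hφ ε
  refine ⟨{ toFun := fun f => (hL f).toLp, map_add' := fun f g => ?_, map_smul' := fun r f => ?_ },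
    fun f => (hL f).coeFn_toLp⟩
  · apply Lp.ext
    filter_upwards [(hL (f + g)).coeFn_toLp, (hL f).coeFn_toLp, (hL g).coeFn_toLp,
      Lp.coeFn_add (hL f).toLp (hL g).toLp, hq.ae (Lp.coeFn_add f g)] with y h1 h2 h3 h4 h5
    rw [h1, h4, Pi.add_apply, h2, h3, h5, Pi.add_apply]
    ring
  · apply Lp.ext
    filter_upwards [(hL (r • f)).coeFn_toLp, (hL f).coeFn_toLp,
      Lp.coeFn_smul r (hL f).toLp, hq.ae (Lp.coeFn_smul r f)] with y h1 h2 h3 h4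
    rw [RingHom.id_apply, h1, h3, Pi.smul_apply, h2, h4, Pi.smul_apply, smul_eq_mul, smul_eq_mul]
    ring

theorem J_weightedComp (hK : IsCompact K) (hM : IsCompact M)
    (hM0 : 0 < volume M) (hψ : IsIncreasingLipeo (volume.real M) (volume.real K) ψ)
    (hφ : IsIncreasingLift K M ψ φ) {ε : ℝ} {f : LInf K} {g : LInf M}
    (h : ∀ᵐ y ∂(volume.restrict M), g y = ε * f (zeroExtend φ y) * deriv ψ (proj M y)) (y : M) :
    J M g y = ε * J K f (φ y) := by
  obtain ⟨c, hc, C, hw⟩ := weight_bounds hM hM0 hψ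
  have hae : g =ᵐ[volume.restrict M]
      fun z => ε * ((deriv ψ (proj M z)).toNNReal • f (zeroExtend φ z)) := by
    filter_upwards [h, hw] with z hz hwz
    rw [hz, NNReal.smul_def, Real.coe_toNNReal _ (hc.le.trans hwz.1), smul_eq_mul]
    ring
  rw [J_eq hM, J_eq hK, setIntegral_congr_ae₀ measurableSet_Iic.nullMeasurableSet
    (hae.mono fun z hz _ => hz), integral_const_mul,
    ← setIntegral_withDensity_eq_setIntegral_smul (weight_measurable hM).real_toNNReal
      _ measurableSet_Iic]
  congr 1
  change ∫ z in Iic (y : ℝ), f (zeroExtend φ z) ∂(pullbackMeasure M ψ) = _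
  have hf := Lp.aestronglyMeasurable f
  -- The type of `f` mentions the measure about to be rewritten, so only the underlying function is
  -- kept.
  generalize (f : ℝ → ℝ) = F at hf ⊢
  rw [← map_zeroExtend hK hM hM0 hψ hφ] at hf ⊢
  rw [setIntegral_congr_set (Iic_ae_eq_zeroExtend hM hφ.1 y),
    setIntegral_map measurableSet_Iic hf (zeroExtend_measurable hM φ.continuous).aemeasurable]

theorem isAssociatedIsometry_weightedComp (hK : IsCompact K) (hM : IsCompact M)
    (hK0 : 0 < volume K) (hM0 : 0 < volume M)
    (hψ : IsIncreasingLipeo (volume.real M) (volume.real K) ψ)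
    (hφ : IsIncreasingLift K M ψ φ) {ε : ℝ} (hε : ε = 1 ∨ ε = -1) {T : LInf K →ₗ[ℝ] LInf M}
    (hT : ∀ f, ∀ᵐ y ∂(volume.restrict M),
      T f y = ε * f (zeroExtend φ y) * deriv ψ (proj M y)) :
    IsAssociatedIsometry K M ψ ε T := by
  have habs : |ε| = 1 := by rcases hε with rfl | rfl <;> simp
  have hsq : ε * ε = 1 := by rcases hε with rfl | rfl <;> norm_num
  refine ⟨fun g => ?_, fun f => ?_, fun f y hy => ?_⟩
  · obtain ⟨c, hc, C, hw⟩ := weight_bounds hM hM0 hψ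
    obtain ⟨B, hB⟩ := LInf_exists_bound g
    have hmap := map_zeroExtend hK hM hM0 hψ hφ
    have hΦ := zeroExtend_measurable hM φ.continuous
    have hΨ := zeroExtend_measurable hK φ.symm.continuous
    have hinv : ∀ y ∈ M, zeroExtend φ.symm (zeroExtend φ y) = y := fun y hy => by
      rw [zeroExtend_apply _ hy, zeroExtend_apply _ (φ ⟨y, hy⟩).2]
      simp
    -- The preimage of `g` is `g' ∘ φ⁻¹`: division undoes the weight, and `ε * ε = 1`.
    let g' : ℝ → ℝ := fun y => ε * g y / deriv ψ (proj M y)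
    have hg' : Measurable g' :=
      ((Lp.stronglyMeasurable g).measurable.const_mul ε).div (weight_measurable hM)
    have hf : MemLp (g' ∘ zeroExtend φ.symm) ∞ (volume.restrict K) := by
      refine memLp_top_of_bound (hg'.comp hΨ).aestronglyMeasurable (B / c) ?_
      rw [← hmap, ae_map_iff hΦ.aemeasurable
        (measurableSet_le (hg'.comp hΨ).norm measurable_const)]
      refine pullbackMeasure_absolutelyContinuous.ae_le ?_
      filter_upwards [ae_restrict_mem hM.measurableSet, hw, hB] with y hy hwy hBy
      have hw0 := hc.trans_le hwy.1
      rw [Function.comp_apply, hinv y hy, norm_div, norm_mul, Real.norm_eq_abs ε, habs, one_mul,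
        Real.norm_of_nonneg hw0.le]
      exact div_le_div₀ ((norm_nonneg _).trans hBy) hBy hc hwy.1
    refine ⟨hf.toLp, Lp.ext ?_⟩
    filter_upwards [hT hf.toLp, ae_restrict_mem hM.measurableSet, hw,
      (zeroExtend_quasiMeasurePreserving hK hM hM0 hψ hφ).ae hf.coeFn_toLp] with y h1 hy hwy h2
    have hw0 := (hc.trans_le hwy.1).ne'
    rw [h1, h2, Function.comp_apply, hinv y hy]
    change ε * (ε * g y / deriv ψ (proj M y)) * deriv ψ (proj M y) = g y
    rw [mul_assoc, div_mul_cancel₀ _ hw0, ← mul_assoc, hsq, one_mul]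
  · rw [normA, normA, ← φ.toEquiv.iSup_comp]
    congr 1
    ext y
    rw [J_weightedComp hK hM hM0 hψ hφ (hT f), abs_mul, habs, one_mul]
    rfl
  · rw [J_weightedComp hK hM hM0 hψ hφ (hT f) ⟨y, hy⟩, ← hφ.2 ⟨y, hy⟩]
    congr 1
    exact J_congr_proj hK hK0 f (sel_isLeast hK hK0 (proj_mem_Icc hK _)).1.2.symm

theorem IsAssociatedIsometry.unique (hM : IsCompact M) {ε : ℝ} {T T' : LInf K →ₗ[ℝ] LInf M}
    (hT : IsAssociatedIsometry K M ψ ε T) (hT' : IsAssociatedIsometry K M ψ ε T') : T = T' :=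
  LinearMap.ext fun f => LInf_ext M hM fun y hy => by
    rw [hT.primitive f y hy, hT'.primitive f y hy]

end Lift

/-! ### Construction of the lift. -/

/-- On a compact space with closed order, the topology is the order topology. -/
theorem orderTopology_of_compactSpace {X : Type*} [LinearOrder X] [t : TopologicalSpace X]
    [OrderClosedTopology X] [CompactSpace X] : OrderTopology X := by
  refine ⟨le_antisymm (le_generateFrom ?_) ?_⟩
  · rintro s ⟨a, rfl | rfl⟩
    · exact isOpen_Ioi
    · exact isOpen_Iio
  · let t' : TopologicalSpace X := Preorder.topology X
    have : @OrderTopology X t' _ := @OrderTopology.mk X t' _ rfl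
    have hle : t ≤ t' := by
      refine le_generateFrom ?_
      rintro s ⟨a, rfl | rfl⟩
      · exact @isOpen_Ioi X t _ _ a
      · exact @isOpen_Iio X t _ _ a
    have hT2 : @T2Space X t' := inferInstance
    -- The identity is a continuous bijection from a compact space to a Hausdorff one, hence a
    -- homeomorphism.
    have hc : @Continuous X X t t' (Equiv.refl X) := continuous_id_iff_le.2 hle
    exact continuous_id_iff_le.1 (@Homeomorph.continuous_invFun X X t t'
      (@Continuous.homeoOfEquivCompactToT2 X X t t' _ hT2 _ hc))

theorem exists_isIncreasingLift {K M : Set ℝ} {ψ : ℝ → ℝ} (hK : IsCompact K) (hM : IsCompact M)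
    (hK0 : 0 < volume K) (hM0 : 0 < volume M)
    (hψ : IsIncreasingLipeo (volume.real M) (volume.real K) ψ) (hc : FiberCompatible K M ψ) :
    ∃ φ : M ≃ₜ K, IsIncreasingLift K M ψ φ := by
  -- Off `E M`, and so off `E K` after applying `ψ`, both fibers are single points.
  have hfib : ∀ s ∈ Icc 0 (volume.real M), Nonempty (fiber M s ≃o fiber K (ψ s)) := by
    intro s hs
    by_cases hE : s ∈ E M
    · exact hc.2 s hE
    have hψs := hψ.bijOn.mapsTo hs
    have hEK : ψ s ∉ E K := by
      rw [← hc.1]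
      rintro ⟨s', hs', h⟩
      exact hE (hψ.bijOn.injOn hs'.1 hs h ▸ hs')
    have h1 : (fiber M s).Subsingleton := not_nontrivial_iff.1 fun h => hE ⟨hs, h⟩
    have h2 : (fiber K (ψ s)).Subsingleton := not_nontrivial_iff.1 fun h => hEK ⟨hψs, h⟩
    obtain ⟨x, hx⟩ := fiber_nonempty hM hM0 hs
    obtain ⟨z, hz⟩ := fiber_nonempty hK hK0 hψs
    refine ⟨⟨⟨fun _ => ⟨z, hz⟩, fun _ => ⟨x, hx⟩, fun u => Subtype.ext (h1 hx u.2),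
      fun u => Subtype.ext (h2 hz u.2)⟩, fun {u v} => ?_⟩⟩
    exact iff_of_true le_rfl (Subtype.coe_le_coe.1 (h1 u.2 v.2).le)
  let e := fun (s : ℝ) (hs : s ∈ Icc 0 (volume.real M)) => (hfib s hs).some
  let F : M → K := fun y =>
    ⟨e (proj M y) (proj_mem_Icc hM y) ⟨y, y.2, rfl⟩, (e (proj M y) (proj_mem_Icc hM y) _).2.1⟩
  have hF : ∀ (s : ℝ) (hs : s ∈ Icc 0 (volume.real M)) (y : ℝ) (hy : y ∈ fiber M s),
      (F ⟨y, hy.1⟩ : ℝ) = e s hs ⟨y, hy⟩ := by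
    rintro s hs y ⟨hy, rfl⟩
    rfl
  have hproj : ∀ y : M, proj K (F y) = ψ (proj M y) := fun y =>
    (e (proj M y) (proj_mem_Icc hM y) ⟨y, y.2, rfl⟩).2.2
  have hmono : StrictMono F := by
    intro y y' hlt
    rcases (proj_mono hM (Subtype.coe_lt_coe.2 hlt).le).lt_or_eq with h | h
    · have h' := hψ.strictMonoOn (proj_mem_Icc hM y) (proj_mem_Icc hM y') h
      rw [← hproj, ← hproj] at h'
      exact Subtype.coe_lt_coe.1 ((proj_mono hK).reflect_lt h')
    -- With equal projections, both values are rewritten through one fiber isomorphism.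
    · rw [← Subtype.coe_lt_coe]
      have h1 := hF _ (proj_mem_Icc hM y') y ⟨y.2, h⟩
      have h2 := hF _ (proj_mem_Icc hM y') y' ⟨y'.2, rfl⟩
      rw [Subtype.coe_eta] at h1 h2
      rw [h1, h2, Subtype.coe_lt_coe, OrderIso.lt_iff_lt]
      exact hlt
  have hsurj : Function.Surjective F := by
    rintro ⟨x, hx⟩
    obtain ⟨s, hs, hsx⟩ := hψ.bijOn.surjOn (proj_mem_Icc hK x)
    let y := (e s hs).symm ⟨x, hx, hsx.symm⟩
    refine ⟨⟨y, y.2.1⟩, Subtype.ext ?_⟩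
    rw [hF s hs y y.2]
    simp [y]
  have : CompactSpace K := isCompact_iff_compactSpace.1 hK
  have : CompactSpace M := isCompact_iff_compactSpace.1 hM
  have : OrderTopology K := orderTopology_of_compactSpace
  have : OrderTopology M := orderTopology_of_compactSpace
  exact ⟨(hmono.orderIsoOfSurjective F hsurj).toHomeomorph, hmono, hproj⟩

end Alexiewicz

theorem corollary4p7 (K M : Set ℝ) (hK : IsCompact K) (hM : IsCompact M)
    (hK0 : 0 < volume K) (hM0 : 0 < volume M) (ψ : ℝ → ℝ)
    (hψ : Alexiewicz.IsIncreasingLipeo (volume.real M) (volume.real K) ψ)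
    (hc : Alexiewicz.FiberCompatible K M ψ) (ε : ℝ) (hε : ε = 1 ∨ ε = -1) :
    (∃! T : Alexiewicz.LInf K →ₗ[ℝ] Alexiewicz.LInf M,
      Alexiewicz.IsAssociatedIsometry K M ψ ε T) ∧
    (∃ φ : M ≃ₜ K, Alexiewicz.IsIncreasingLift K M ψ φ) ∧
    (∀ φ : M ≃ₜ K, Alexiewicz.IsIncreasingLift K M ψ φ →
      (∀ᵐ y ∂(volume : Measure ℝ), ∀ hy : y ∈ M,
        (φ ⟨y, hy⟩ : ℝ) = Alexiewicz.sel K (ψ (Alexiewicz.proj M y))) ∧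
      ∀ T : Alexiewicz.LInf K →ₗ[ℝ] Alexiewicz.LInf M,
        Alexiewicz.IsAssociatedIsometry K M ψ ε T →
        ∀ f : Alexiewicz.LInf K, ∀ᵐ y ∂(volume : Measure ℝ), ∀ hy : y ∈ M,
          T f y = ε * f (φ ⟨y, hy⟩ : ℝ) *
            derivWithin ψ (Icc 0 (volume.real M)) (Alexiewicz.proj M y)) := by
  obtain ⟨φ₀, hφ₀⟩ := Alexiewicz.exists_isIncreasingLift hK hM hK0 hM0 hψ hc
  obtain ⟨T₀, hT₀⟩ := Alexiewicz.exists_weightedComp hK hM hM0 hψ hφ₀ ε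
  refine ⟨⟨T₀, Alexiewicz.isAssociatedIsometry_weightedComp hK hM hK0 hM0 hψ hφ₀ hε hT₀,
    fun T hT => hT.unique hM
      (Alexiewicz.isAssociatedIsometry_weightedComp hK hM hK0 hM0 hψ hφ₀ hε hT₀)⟩,
    ⟨φ₀, hφ₀⟩, fun φ hφ => ⟨?_, fun T hT f => ?_⟩⟩
  · have hsel := (Alexiewicz.zeroExtend_quasiMeasurePreserving hK hM hM0 hψ hφ).ae
      (Alexiewicz.sel_proj_ae hK hK0)
    rw [ae_restrict_iff' hM.measurableSet] at hsel
    filter_upwards [hsel] with y h hy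
    have h' := h hy
    rw [Alexiewicz.zeroExtend_apply _ hy, hφ.2] at h'
    exact h'.symm
  -- The given lift defines its own weighted composition; uniqueness identifies it with `T`.
  · obtain ⟨T', hT'⟩ := Alexiewicz.exists_weightedComp hK hM hM0 hψ hφ ε
    obtain rfl : T = T' := hT.unique hM
      (Alexiewicz.isAssociatedIsometry_weightedComp hK hM hK0 hM0 hψ hφ hε hT')
    obtain ⟨c, -, C, hw⟩ := Alexiewicz.weight_bounds hM hM0 hψ
    have hTf := hT' f
    rw [ae_restrict_iff' hM.measurableSet] at hTf hw
    filter_upwards [hTf, hw] with y h1 h2 hy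
    rw [h1 hy, (h2 hy).2.2, Alexiewicz.zeroExtend_apply _ hy]
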